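/- Let $N\ge 1$ and let $p_1,\dots,p_N\ge 0$ satisfy $p_1+\dots+p_N=1$. Put $Q(z)=\sum_{j=1}^N p_j z^j$ and, for $\rho\in L^1(\mathbb R)$, $\mathbb Q[\rho]=\sum_{j=1}^N p_j\,\rho^{*j}$, where $\rho^{*j}$ is the $j$-fold convolution power. Let $\phi$ be the analytic function on the open unit disk with $\phi'(z)=\frac{1}{1-Q(z)}$ and $\phi(0)=0$ (for $Q(z)=z^2$ this is $\phi(z)=\frac12\log\frac{1+z}{1-z}$). Let $$\mathbb P=\Big\{\eta\in L^1((1,\infty),\mathbb R_+)\ :\ \int_1^\infty\eta(y)\,dy=1\Big\},$$ whose elements are extended by $0$ to $\mathbb R$. For functions on $[1,\infty)$, extended by $0$ to $\mathbb R$, and $\tau\ge 0$, put $(S_\tau w)(y)=e^\tau w(e^\tau y)$ if $y\ge 1$ and $(S_\tau w)(y)=0$ if $y<1$; also put $(T_1f)(y)=f(y-1)$ if $y\ge 2$ and $(T_1f)(y)=0$ if $y<2$. Write $(\mathcal F f)(\xi)=\int_1^\infty e^{-i\xi x}f(x)\,dx$ for complex $\xi$ with $\operatorname{Im}\xi<0$,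 and for $\rho\in\mathbb P$ let $\mathcal N(\rho)=(\mathcal F^{-1}\circ\phi\circ\mathcal F)(\rho)$, that is, $\mathcal N(\rho)$ is the function $w\in L^1_{\rm loc}([1,\infty),\mathbb R)$ (unique up to null sets) such that $e^{-\varepsilon x}w(x)$ is integrable on $(1,\infty)$ for all $\varepsilon>0$ and $\mathcal F w(\xi)=\phi(\mathcal F\rho(\xi))$ for all $\xi$ with $\operatorname{Im}\xi<0$. Let $\eta_0\in\mathbb P$ and let $\eta\in C^0([0,\infty),\mathbb P)$, with $\mathbb P$ carrying the $L^1$ norm topology, be the solution of $$\eta(\tau)=S_\tau\eta_0+\int_0^\tau\beta(s)\,S_{\tau-s}T_1\mathbb Q[\eta(s)]\,ds\qquad(\tau\ge 0),$$ where the trace $\beta$ of $\eta$ is given by $\beta(\tau)=e^{\tau-\tau_0}\,\eta(\tau_0,e^{\tau-\tau_0})$ for all $\tau_0\ge 0$ and almost all $\tau\in[\tau_0,\tau_0+\log 2]$. Then, for all $\tau\ge 0$, $\mathcal N(\eta(\tau))$ exists and $$\mathcal N(\eta(\tau))=S_\tau\,\mathcal N(\eta_0)\qquad\text{almost everywhere.}$$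 -/

import Mathlib

open MeasureTheory Set

noncomputable section

namespace Coarsening

/-- The polynomial `Q(z) = p₁ z + ⋯ + p_N z^N` on the complex plane. -/
def Qpoly (N : ℕ) (p : ℕ → ℝ) (z : ℂ) : ℂ :=
  ∑ j ∈ Finset.Icc 1 N, (p j : ℂ) * z ^ j

/-- The convolution power `ρ^{*j} = ρ * ⋯ * ρ` (`j ≥ 1` factors) on the real line.
The value at `j = 0`, which is never used, is set to `0`. -/
def convPow (ρ : ℝ → ℝ) : ℕ → ℝ → ℝ
  | 0 => 0
  | 1 => ρ
  | j + 2 => convolution ρ (convPow ρ (j + 1)) (ContinuousLinearMap.mul ℝ ℝ) volume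

/-- The convolution polynomial `ℚ[ρ] = ∑_{j=1}^N p_j ρ^{*j}`. -/
def Qconv (N : ℕ) (p : ℕ → ℝ) (ρ : ℝ → ℝ) : ℝ → ℝ :=
  fun x => ∑ j ∈ Finset.Icc 1 N, p j * convPow ρ j x

/-- The shift operator: `(T₁ f)(y) = f(y - 1)` if `y ≥ 2`, and `0` if `y < 2`. -/
def shiftOne (f : ℝ → ℝ) : ℝ → ℝ :=
  indicator (Ici 2) fun y => f (y - 1)

/-- The dilation operator: `(S_τ f)(y) = e^τ f(e^τ y)` if `y ≥ 1`, and `0` if `y < 1`. -/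
def dilation (τ : ℝ) (f : ℝ → ℝ) : ℝ → ℝ :=
  indicator (Ici 1) fun y => Real.exp τ * f (Real.exp τ * y)

theorem integrable_convPow {ρ : ℝ → ℝ} (hρ : Integrable ρ) :
    ∀ j : ℕ, Integrable (convPow ρ j)
  | 0 => integrable_zero _ _ _
  | 1 => hρ
  | j + 2 => hρ.integrable_convolution (ContinuousLinearMap.mul ℝ ℝ)
      (integrable_convPow hρ (j + 1))

theorem integrable_Qconv (N : ℕ) (p : ℕ → ℝ) {ρ : ℝ → ℝ} (hρ : Integrable ρ) :
    Integrable (Qconv N p ρ) :=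
  integrable_finsetSum _ fun j _ => (integrable_convPow hρ j).const_mul (p j)

theorem integrable_shiftOne {f : ℝ → ℝ} (hf : Integrable f) : Integrable (shiftOne f) :=
  (hf.comp_sub_right 1).indicator measurableSet_Ici

theorem integrable_dilation (τ : ℝ) {f : ℝ → ℝ} (hf : Integrable f) :
    Integrable (dilation τ f) :=
  ((hf.comp_mul_left' (Real.exp_ne_zero τ)).const_mul (Real.exp τ)).indicator measurableSet_Ici

/-- The Banach space `L¹(ℝ)`. The space `L¹((1,∞))` is identified, through extension by zero,
with the closed subspace of those elements that vanish almost everywhere below `1`. -/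
abbrev L1R : Type := Lp ℝ 1 (volume : Measure ℝ)

/-- `S_τ` as a map of `L¹`. -/
def dilationL1 (τ : ℝ) (f : L1R) : L1R :=
  (integrable_dilation τ (L1.integrable_coeFn f)).toL1 (dilation τ f)

/-- The map `f ↦ T₁ ℚ[f]` of `L¹`. -/
def shiftQconvL1 (N : ℕ) (p : ℕ → ℝ) (f : L1R) : L1R :=
  (integrable_shiftOne (integrable_Qconv N p (L1.integrable_coeFn f))).toL1
    (shiftOne (Qconv N p f))

/-- The set `ℙ` of probability densities on `(1,∞)`, extended by zero to `ℝ`. -/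
def probDensities : Set L1R :=
  {f | (∀ᵐ x, x < 1 → f x = 0) ∧ (∀ᵐ x, 0 ≤ f x) ∧ ∫ x in Ioi (1 : ℝ), f x = 1}

/-- `β` is the trace of `η`: for every `τ₀ ≥ 0`, one has
`β(τ) = e^{τ-τ₀} η(τ₀, e^{τ-τ₀})` for almost all `τ` in `[τ₀, τ₀ + log 2]`. -/
def IsTrace (η : ℝ → L1R) (β : ℝ → ℝ) : Prop :=
  ∀ τ₀ : ℝ, 0 ≤ τ₀ → ∀ᵐ τ : ℝ, τ ∈ Icc τ₀ (τ₀ + Real.log 2) →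
    β τ = Real.exp (τ - τ₀) * η τ₀ (Real.exp (τ - τ₀))

/-- `η ∈ C⁰([0,∞), ℙ)` is a solution with initial value `η₀` of the rescaled coarsening equation
`∂_τ η = ∂_y (y η) + β(τ) T₁ ℚ[η]`, in the integrated form
`η(τ) = S_τ η₀ + ∫_0^τ β(s) S_{τ-s} T₁ ℚ[η(s)] ds` (a Bochner integral in `L¹`),
where `β` is the trace of `η`. Only the values `η τ` with `τ ≥ 0` matter. -/
structure IsSolution (N : ℕ) (p : ℕ → ℝ) (η₀ : L1R) (η : ℝ → L1R) : Prop where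
  continuousOn : ContinuousOn η (Ici 0)
  mem : ∀ τ : ℝ, 0 ≤ τ → η τ ∈ probDensities
  integral_eq : ∃ β : ℝ → ℝ, IsTrace η β ∧ ∀ τ : ℝ, 0 ≤ τ →
    η τ = dilationL1 τ η₀ + ∫ s in (0 : ℝ)..τ, β s • dilationL1 (τ - s) (shiftQconvL1 N p (η s))

/-- The function `φ` with `φ' = 1 / (1 - Q)` and `φ(0) = 0` on the open unit disk, written as the
integral of `1 / (1 - Q)` along the segment from `0` to `z`. -/
def phi (N : ℕ) (p : ℕ → ℝ) (z : ℂ) : ℂ :=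
  ∫ t in (0 : ℝ)..1, z / (1 - Qpoly N p (t * z))

/-- The Fourier transform `∫_1^∞ e^{-iξx} f(x) dx` of a function on `[1,∞)`, at a complex `ξ`
of the lower half plane. -/
def fourier (f : ℝ → ℝ) (ξ : ℂ) : ℂ :=
  ∫ x in Ioi (1 : ℝ), Complex.exp (-Complex.I * ξ * x) * (f x : ℂ)

/-- `w ∈ L¹_loc([1,∞), ℝ)`, extended by zero to `ℝ`, has Fourier transform `g` in the open lower
half plane. The integrability of `e^{-εx} w(x)` for all `ε > 0` says that the integral which
defines the Fourier transform converges absolutely there. -/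
structure HasFourier (w : ℝ → ℝ) (g : ℂ → ℂ) : Prop where
  eq_zero : ∀ x : ℝ, x < 1 → w x = 0
  locallyIntegrableOn : LocallyIntegrableOn w (Ici 1)
  integrable_exp : ∀ ε : ℝ, 0 < ε →
    IntegrableOn (fun x : ℝ => Real.exp (-ε * x) * w x) (Ioi 1)
  fourier_eq : ∀ ξ : ℂ, ξ.im < 0 → fourier w ξ = g ξ

open Classical in
/-- The inverse Fourier transform `𝓕⁻¹ g`: the function `w ∈ L¹_loc([1,∞), ℝ)` (unique up to a null
set) whose Fourier transform in the open lower half plane is `g`; `0` if there is none. -/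
def fourierInv (g : ℂ → ℂ) : ℝ → ℝ :=
  if h : ∃ w, HasFourier w g then h.choose else 0

/-- The nonlinear map `𝒩 = 𝓕⁻¹ ∘ φ ∘ 𝓕`. -/
def Nmap (N : ℕ) (p : ℕ → ℝ) (ρ : ℝ → ℝ) : ℝ → ℝ :=
  fourierInv fun ξ => phi N p (fourier ρ ξ)

end Coarsening

end

/-!
The characteristics of the equation in Fourier variables are `s ↦ e^s ξ`. Testing the integrated
equation against exponentials on `(e^{t-s}, ∞)`, for `τ ≤ t ≤ τ + log 2`, gives
`𝓕η(t)(e^t ξ) - 𝓕η(τ)(e^τ ξ) = -∫_τ^t β(s) e^{-i e^s ξ} (1 - Q(𝓕η(s)(e^s ξ))) ds`: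
the trace supplies the part of `𝓕η(τ)` that leaves through `(1, e^{t-τ})`, and since `T₁ ℚ[η(s)]` is
supported in `[2, ∞)`, the cutoff at `e^{t-s} ≤ 2` does not affect it. As `φ' = 1 / (1 - Q)`, the
function `φ` linearises this equation: `φ(𝓕η(s)(e^s ξ))` has derivative `-β(s) e^{-i e^s ξ}`. It
tends to `φ(0) = 0` as `s → ∞`, because `|𝓕η(s)(e^s ξ)| ≤ exp(e^s Im ξ)`, and therefore
`φ(𝓕η(τ)(e^τ ξ)) = ∫_τ^∞ β(s) e^{-i e^s ξ} ds`. The substitution `x = e^{s-τ}` identifies the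
right-hand side with the Fourier transform of `S_τ w` at `e^τ ξ`, where `w(x) = β(log x) / x`.
-/

noncomputable section

namespace Coarsening

open Filter Topology
open scoped FourierTransform

theorem absolutelyContinuousOnInterval_of_dist_le {X Y : Type*} [PseudoMetricSpace X]
    [PseudoMetricSpace Y] {f : ℝ → X} {g : ℝ → Y} {a b : ℝ} (K : ℝ)
    (hg : AbsolutelyContinuousOnInterval g a b)
    (h : ∀ s ∈ uIcc a b, ∀ t ∈ uIcc a b, dist (f s) (f t) ≤ K * dist (g s) (g t)) :
    AbsolutelyContinuousOnInterval f a b := by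
  have hKg := Tendsto.const_mul K hg
  rw [mul_zero] at hKg
  refine squeeze_zero' (Eventually.of_forall fun _ => Finset.sum_nonneg fun _ _ => dist_nonneg)
    (eventually_inf_principal.2 (Eventually.of_forall fun E hE => ?_)) hKg
  rw [Finset.mul_sum]
  exact Finset.sum_le_sum fun i hi => h _ (hE.1 i hi).1 _ (hE.1 i hi).2

theorem absolutelyContinuousOnInterval_integral {E : Type*} [NormedAddCommGroup E]
    [NormedSpace ℝ E] {f : ℝ → E} {a b : ℝ} (hf : IntervalIntegrable f volume a b) :
    AbsolutelyContinuousOnInterval (fun t => ∫ u in a..t, f u) a b := by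
  refine absolutelyContinuousOnInterval_of_dist_le 1
    (hf.norm.absolutelyContinuousOnInterval_intervalIntegral left_mem_uIcc) fun s hs t ht => ?_
  have hfs : IntervalIntegrable f volume a s := hf.mono_set (uIcc_subset_uIcc_left hs)
  have hft : IntervalIntegrable f volume a t := hf.mono_set (uIcc_subset_uIcc_left ht)
  rw [one_mul, dist_eq_norm, Real.dist_eq, intervalIntegral.integral_interval_sub_left hfs hft,
    intervalIntegral.integral_interval_sub_left hfs.norm hft.norm]
  exact intervalIntegral.norm_integral_le_abs_integral_norm

theorem sub_eq_integral_deriv_mul {φ φ' : ℂ → ℂ} {U : Set ℂ} (hU : IsOpen U)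
    (hφ : ∀ z ∈ U, HasDerivAt φ (φ' z) z) {y g : ℝ → ℂ} {a b : ℝ} (hab : a ≤ b)
    (hg : IntervalIntegrable g volume a b)
    (hy : ∀ t ∈ Icc a b, y t = y a + ∫ u in a..t, g u) (hyU : MapsTo y (Icc a b) U) :
    φ (y b) - φ (y a) = ∫ u in a..b, φ' (y u) * g u := by
  rw [← uIcc_of_le hab] at hy hyU
  have hyAC : AbsolutelyContinuousOnInterval y a b :=
    absolutelyContinuousOnInterval_of_dist_le 1 (absolutelyContinuousOnInterval_integral hg)
      fun s hs t ht => by rw [hy s hs, hy t ht, dist_add_left, one_mul]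
  have hφU : AnalyticOnNhd ℂ φ U := DifferentiableOn.analyticOnNhd
    (fun z hz => (hφ z hz).differentiableAt.differentiableWithinAt) hU
  have hφAC : AbsolutelyContinuousOnInterval (φ ∘ y) a b := by
    obtain ⟨K, hK⟩ := LocallyLipschitzOn.exists_lipschitzOnWith_of_compact
      (isCompact_uIcc.image_of_continuousOn hyAC.continuousOn) (f := φ) <| by
        rintro _ ⟨t, ht, rfl⟩
        obtain ⟨K, V, hV, hK⟩ := ((hφU _ (hyU ht)).contDiffAt (n := 1)).exists_lipschitzOnWith
        exact ⟨K, V, mem_nhdsWithin_of_mem_nhds hV, hK⟩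
    exact absolutelyContinuousOnInterval_of_dist_le K hyAC fun s hs t ht =>
      hK.dist_le_mul _ (mem_image_of_mem y hs) _ (mem_image_of_mem y ht)
  have hderiv : IntervalIntegrable (fun u => φ' (y u) * g u) volume a b := by
    have hφ' : ContinuousOn φ' U := hφU.deriv.continuousOn.congr fun z hz => (hφ z hz).deriv.symm
    exact hg.continuousOn_mul (hφ'.comp hyAC.continuousOn hyU)
  obtain ⟨C, hC⟩ :=
    (hφAC.sub (absolutelyContinuousOnInterval_integral hderiv)).const_of_ae_hasDerivAt_zero <| by
      have hends : ∀ᵐ x : ℝ, x ∉ ({a, b} : Set ℝ) :=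
        measure_eq_zero_iff_ae_notMem.1 ((Set.toFinite _).measure_zero _)
      filter_upwards [hg.ae_hasDerivAt_integral, hderiv.ae_hasDerivAt_integral, hends]
        with t hgt hdt hne ht
      have hnear : uIcc a b ∈ 𝓝 t := by
        rw [uIcc_of_le hab] at ht ⊢
        simp only [mem_insert_iff, mem_singleton_iff, not_or] at hne
        exact Icc_mem_nhds (lt_of_le_of_ne' ht.1 hne.1) (lt_of_le_of_ne ht.2 hne.2)
      have hyt : HasDerivAt y (g t) t :=
        ((hgt ht a left_mem_uIcc).const_add (y a)).congr_of_eventuallyEq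
          (mem_of_superset hnear hy)
      simpa using ((hφ _ (hyU ht)).comp t hyt).sub (hdt ht a left_mem_uIcc)
  have hCab := (hC b right_mem_uIcc).trans (hC a left_mem_uIcc).symm
  simpa [sub_eq_iff_eq_add, add_comm] using hCab

theorem forall_nonneg_of_step {P : ℝ → Prop} {δ : ℝ} (hδ : 0 < δ) (zero : P 0)
    (step : ∀ s t, 0 ≤ s → s ≤ t → t ≤ s + δ → P s → P t) : ∀ t, 0 ≤ t → P t := by
  have hmul (n : ℕ) : P (n * δ) := by
    induction n with
    | zero => simpa using zero
    | succ n ih =>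
      refine step (n * δ) _ (by positivity) ?_ ?_ ih <;>
        · push_cast
          linarith
  intro t ht
  refine step (⌊t / δ⌋₊ * δ) t (by positivity)
    ((le_div_iff₀ hδ).1 (Nat.floor_le (by positivity))) ?_ (hmul _)
  linarith [(div_lt_iff₀ hδ).1 (Nat.lt_floor_add_one (t / δ))]

theorem ae_eq_of_fourier_eq {V E : Type*} [NormedAddCommGroup V] [InnerProductSpace ℝ V]
    [FiniteDimensional ℝ V] [MeasurableSpace V] [BorelSpace V] [NormedAddCommGroup E]
    [NormedSpace ℂ E] [CompleteSpace E] {f g : V → E} (hf : Integrable f) (hg : Integrable g)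
    (h : 𝓕 f = 𝓕 g) : f =ᵐ[volume] g := by
  have selfAdjoint (φ : SchwartzMap V ℂ) {u : V → E} (hu : Integrable u) :
      ∫ x, 𝓕 φ x • u x = ∫ x, φ x • 𝓕 u x := by
    simpa using! VectorFourier.integral_fourierIntegral_smul_eq_flip (L := innerₗ V)
      Real.continuous_fourierChar continuous_inner φ.integrable hu
  refine ae_eq_of_integral_contDiff_smul_eq hf.locallyIntegrable hg.locallyIntegrable
    fun ψ hψ hsupp => ?_
  let Ψ : SchwartzMap V ℂ := (hsupp.comp_left Complex.ofReal_zero).toSchwartzMap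
    (Complex.ofRealCLM.contDiff.comp hψ)
  have hΨ (u : V → E) : ∫ x, ψ x • u x = ∫ x, 𝓕 (𝓕⁻ Ψ) x • u x := by
    rw [FourierTransform.fourier_fourierInv_eq]
    exact integral_congr_ae (ae_of_all _ fun x => (Complex.coe_smul (ψ x) (u x)).symm)
  rw [hΨ, hΨ, selfAdjoint _ hf, selfAdjoint _ hg, h]

theorem hasDerivAt_integral_segment {f : ℂ → ℂ} {r : ℝ} {z : ℂ}
    (hf : DifferentiableOn ℂ f (Metric.ball 0 r)) (hz : z ∈ Metric.ball 0 r) :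
    HasDerivAt (fun w => w * ∫ t in (0 : ℝ)..1, f (t * w)) (f z) z := by
  obtain ⟨F, hF⟩ := hf.isExactOn_ball
  refine ((hF z hz).sub_const (F 0)).congr_of_eventuallyEq ?_
  filter_upwards [Metric.isOpen_ball.mem_nhds hz] with w hw
  have hmem : ∀ t ∈ Icc (0 : ℝ) 1, (0 : ℂ) + t • w ∈ Metric.ball 0 r := fun t ht =>
    (convex_ball 0 r).add_smul_mem (Metric.mem_ball_self (Metric.pos_of_mem_ball hw))
      (by rwa [zero_add]) ht
  simpa using intervalIntegral.integral_unitInterval_deriv_eq_sub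
    (hf.continuousOn.comp (by fun_prop) hmem) fun t ht => hF _ (hmem t ht)

theorem differentiable_Qpoly (N : ℕ) (p : ℕ → ℝ) : Differentiable ℂ (Qpoly N p) := by
  unfold Qpoly
  fun_prop

theorem norm_Qpoly_le {N : ℕ} {p : ℕ → ℝ} (hp : ∀ j ∈ Finset.Icc 1 N, 0 ≤ p j) {z : ℂ}
    (hz : ‖z‖ ≤ 1) : ‖Qpoly N p z‖ ≤ (∑ j ∈ Finset.Icc 1 N, p j) * ‖z‖ := by
  rw [Finset.sum_mul]
  refine norm_sum_le_of_le _ fun j hj => ?_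
  rw [norm_mul, norm_pow, Complex.norm_real, Real.norm_of_nonneg (hp j hj)]
  have hj0 : j ≠ 0 := Nat.one_le_iff_ne_zero.1 (Finset.mem_Icc.1 hj).1
  exact mul_le_mul_of_nonneg_left (pow_le_of_le_one (norm_nonneg z) hz hj0) (hp j hj)

theorem Qpoly_ne_one {N : ℕ} {p : ℕ → ℝ} (hp : ∀ j ∈ Finset.Icc 1 N, 0 ≤ p j)
    (hp1 : ∑ j ∈ Finset.Icc 1 N, p j ≤ 1) {z : ℂ} (hz : ‖z‖ < 1) : Qpoly N p z ≠ 1 := by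
  intro h
  have hle : ‖Qpoly N p z‖ ≤ ‖z‖ :=
    (norm_Qpoly_le hp hz.le).trans (mul_le_of_le_one_left (norm_nonneg z) hp1)
  rw [h, norm_one] at hle
  exact hle.not_gt hz

theorem phi_zero (N : ℕ) (p : ℕ → ℝ) : phi N p 0 = 0 := by simp [phi]

theorem hasDerivAt_phi {N : ℕ} {p : ℕ → ℝ} (hQ : ∀ z : ℂ, ‖z‖ < 1 → Qpoly N p z ≠ 1)
    {z : ℂ} (hz : ‖z‖ < 1) : HasDerivAt (phi N p) (1 - Qpoly N p z)⁻¹ z := by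
  have hd : DifferentiableOn ℂ (fun w => (1 - Qpoly N p w)⁻¹) (Metric.ball 0 1) := fun w hw =>
    (((differentiable_Qpoly N p w).const_sub 1).inv <|
      sub_ne_zero.2 (hQ w (mem_ball_zero_iff.1 hw)).symm).differentiableWithinAt
  refine (hasDerivAt_integral_segment hd (mem_ball_zero_iff.2 hz)).congr_of_eventuallyEq ?_
  exact Eventually.of_forall fun w => by
    simp only [phi, div_eq_mul_inv, intervalIntegral.integral_const_mul]

theorem integral_norm_convolution_le {G E E' F : Type*} [NormedAddCommGroup E]
    [NormedAddCommGroup E'] [NormedAddCommGroup F] [NormedSpace ℝ E] [NormedSpace ℝ E']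
    [NormedSpace ℝ F] (L : E →L[ℝ] E' →L[ℝ] F) [AddGroup G]
    [MeasurableSpace G] [MeasurableAdd₂ G] [MeasurableNeg G] {μ : Measure G} [SFinite μ]
    [μ.IsAddRightInvariant] {f : G → E} {g : G → E'} (hf : Integrable f μ) (hg : Integrable g μ) :
    ∫ x, ‖convolution f g L μ x‖ ∂μ ≤ ‖L‖ * ((∫ x, ‖f x‖ ∂μ) * ∫ x, ‖g x‖ ∂μ) := by
  rw [← ContinuousLinearMap.mul_apply' ℝ ℝ (∫ x, ‖f x‖ ∂μ),
    ← integral_convolution (ContinuousLinearMap.mul ℝ ℝ) hf.norm hg.norm, ← integral_const_mul]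
  refine integral_mono_ae (hf.integrable_convolution L hg).norm
    ((hf.norm.integrable_convolution _ hg.norm).const_mul _) ?_
  filter_upwards [hf.norm.ae_convolution_exists (ContinuousLinearMap.mul ℝ ℝ) hg.norm] with x hx
  have hle : ∀ t, ‖L (f t) (g (x - t))‖ ≤ ‖L‖ * (‖f t‖ * ‖g (x - t)‖) := fun t =>
    (L.le_opNorm₂ _ _).trans_eq (mul_assoc _ _ _)
  exact (norm_integral_le_of_norm_le (hx.const_mul _) (ae_of_all _ hle)).trans_eq
    (integral_const_mul _ _)

/-- Convolution as a bounded bilinear map on `L¹(ℝ)`. -/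
def convL1 : L1R →L[ℝ] L1R →L[ℝ] L1R :=
  LinearMap.mkContinuous₂
    (LinearMap.mk₂ ℝ (fun f g => ((L1.integrable_coeFn f).integrable_convolution
        (ContinuousLinearMap.mul ℝ ℝ) (L1.integrable_coeFn g)).toL1 _)
      (fun f f' g => by
        rw [← Integrable.toL1_add, Integrable.toL1_eq_toL1_iff,
          convolution_congr _ (Lp.coeFn_add f f') EventuallyEq.rfl]
        filter_upwards [
          (L1.integrable_coeFn f).ae_convolution_exists (.mul ℝ ℝ) (L1.integrable_coeFn g),
          (L1.integrable_coeFn f').ae_convolution_exists (.mul ℝ ℝ) (L1.integrable_coeFn g)]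
          with x hx hx' using hx.add_distrib hx')
      (fun c f g => by
        rw [← Integrable.toL1_smul', Integrable.toL1_eq_toL1_iff,
          convolution_congr _ (Lp.coeFn_smul c f) EventuallyEq.rfl, smul_convolution])
      (fun f g g' => by
        rw [← Integrable.toL1_add, Integrable.toL1_eq_toL1_iff,
          convolution_congr _ EventuallyEq.rfl (Lp.coeFn_add g g')]
        filter_upwards [
          (L1.integrable_coeFn f).ae_convolution_exists (.mul ℝ ℝ) (L1.integrable_coeFn g),
          (L1.integrable_coeFn f).ae_convolution_exists (.mul ℝ ℝ) (L1.integrable_coeFn g')]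
          with x hx hx' using hx.distrib_add hx')
      (fun c f g => by
        rw [← Integrable.toL1_smul', Integrable.toL1_eq_toL1_iff,
          convolution_congr _ EventuallyEq.rfl (Lp.coeFn_smul c g), convolution_smul]))
    1 fun f g => by
      rw [LinearMap.mk₂_apply, L1.norm_of_fun_eq_integral_norm, L1.norm_eq_integral_norm,
        L1.norm_eq_integral_norm, mul_assoc, ← ContinuousLinearMap.opNorm_mul ℝ ℝ]
      exact integral_norm_convolution_le _ (L1.integrable_coeFn f) (L1.integrable_coeFn g)

theorem convL1_toL1 {f g : ℝ → ℝ} (hf : Integrable f) (hg : Integrable g) :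
    convL1 (hf.toL1 f) (hg.toL1 g) =
      (hf.integrable_convolution (ContinuousLinearMap.mul ℝ ℝ) hg).toL1 _ := by
  simp only [convL1, LinearMap.mkContinuous₂_apply, LinearMap.mk₂_apply]
  rw [Integrable.toL1_eq_toL1_iff, convolution_congr _ hf.coeFn_toL1 hg.coeFn_toL1]

theorem continuous_toL1_convPow : ∀ j : ℕ, Continuous fun f : L1R =>
    (integrable_convPow (L1.integrable_coeFn f) j).toL1 (convPow f j)
  | 0 => by simpa only [convPow, Integrable.toL1_zero] using continuous_const
  | 1 => continuous_id.congr fun f => (Integrable.toL1_coeFn f _).symm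
  | j + 2 => by
    refine (convL1.continuous₂.comp
      (continuous_id.prodMk (continuous_toL1_convPow (j + 1)))).congr fun f => ?_
    simpa using! convL1_toL1 (L1.integrable_coeFn f)
      (integrable_convPow (L1.integrable_coeFn f) (j + 1))

theorem continuous_toL1_Qconv (N : ℕ) (p : ℕ → ℝ) : Continuous fun f : L1R =>
    (integrable_Qconv N p (L1.integrable_coeFn f)).toL1 (Qconv N p f) := by
  refine (continuous_finsetSum (Finset.Icc 1 N)
    fun j _ => (continuous_toL1_convPow j).const_smul (p j)).congr fun f => ?_
  refine Lp.ext ((Lp.coeFn_finsetSum _ _).trans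
    (.trans ?_ (Integrable.coeFn_toL1 _).symm))
  filter_upwards [
    ae_all_iff.2 fun j => (integrable_convPow (L1.integrable_coeFn f) j).coeFn_toL1,
    ae_all_iff.2 fun j => Lp.coeFn_smul (p j)
      ((integrable_convPow (L1.integrable_coeFn f) j).toL1 (convPow f j))] with x hconv hsmul
  simp only [Finset.sum_apply, hsmul, Pi.smul_apply, hconv, smul_eq_mul, Qconv]

theorem dist_toL1 {f g : ℝ → ℝ} (hf : Integrable f) (hg : Integrable g) :
    dist (hf.toL1 f) (hg.toL1 g) = ∫ x, ‖f x - g x‖ := by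
  rw [dist_eq_norm, ← Integrable.toL1_sub, L1.norm_of_fun_eq_integral_norm]
  simp only [Pi.sub_apply]

theorem dist_toL1_shiftOne_le {f g : ℝ → ℝ} (hf : Integrable f) (hg : Integrable g) :
    dist ((integrable_shiftOne hf).toL1 _) ((integrable_shiftOne hg).toL1 _) ≤
      dist (hf.toL1 f) (hg.toL1 g) := by
  rw [dist_toL1, dist_toL1, ← integral_sub_right_eq_self (fun x => ‖f x - g x‖) 1]
  refine integral_mono ((integrable_shiftOne hf).sub (integrable_shiftOne hg)).norm
    ((hf.sub hg).norm.comp_sub_right 1) fun x => ?_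
  simp only [shiftOne, ← Pi.sub_apply, ← indicator_sub']
  exact norm_indicator_le_norm_self _ x

theorem continuous_shiftQconvL1 (N : ℕ) (p : ℕ → ℝ) : Continuous (shiftQconvL1 N p) :=
  continuous_iff_continuousAt.2 fun f => tendsto_iff_dist_tendsto_zero.2 <|
    squeeze_zero (fun _ => dist_nonneg) (fun _ => dist_toL1_shiftOne_le _ _)
      (tendsto_iff_dist_tendsto_zero.1 ((continuous_toL1_Qconv N p).tendsto f))

theorem dilation_congr_ae (τ : ℝ) {f g : ℝ → ℝ} (h : f =ᵐ[volume] g) :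
    dilation τ f =ᵐ[volume] dilation τ g := by
  have hmap : Measure.QuasiMeasurePreserving (Real.exp τ * · : ℝ → ℝ) volume volume := by
    refine ⟨measurable_const_mul _, ?_⟩
    rw [Real.map_volume_mul_left (Real.exp_ne_zero τ)]
    exact Measure.smul_absolutelyContinuous
  filter_upwards [hmap.ae_eq_comp h] with x hx
  simp only [Function.comp_apply] at hx
  simp only [dilation, indicator, hx]

theorem dist_toL1_dilation_le (τ : ℝ) {f g : ℝ → ℝ} (hf : Integrable f) (hg : Integrable g) :
    dist ((integrable_dilation τ hf).toL1 _) ((integrable_dilation τ hg).toL1 _) ≤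
      dist (hf.toL1 f) (hg.toL1 g) := by
  have hscale : ∫ x, ‖Real.exp τ * f (Real.exp τ * x) - Real.exp τ * g (Real.exp τ * x)‖ =
      ∫ x, ‖f x - g x‖ := by
    simp_rw [← mul_sub, norm_mul]
    rw [integral_const_mul, Measure.integral_comp_mul_left (fun x => ‖f x - g x‖), smul_eq_mul,
      abs_inv, Real.norm_eq_abs, mul_inv_cancel_left₀ (abs_ne_zero.2 (Real.exp_ne_zero τ))]
  have hdil {u : ℝ → ℝ} (hu : Integrable u) :
      Integrable fun x => Real.exp τ * u (Real.exp τ * x) :=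
    (hu.comp_mul_left' (Real.exp_ne_zero τ)).const_mul _
  rw [dist_toL1, dist_toL1, ← hscale]
  refine integral_mono ((integrable_dilation τ hf).sub (integrable_dilation τ hg)).norm
    ((hdil hf).sub (hdil hg)).norm fun x => ?_
  simp only [dilation, ← Pi.sub_apply, ← indicator_sub']
  exact norm_indicator_le_norm_self _ x

theorem dist_dilationL1_le (τ : ℝ) (f g : L1R) :
    dist (dilationL1 τ f) (dilationL1 τ g) ≤ dist f g := by
  simpa only [dilationL1, Integrable.toL1_coeFn] using
    dist_toL1_dilation_le τ (L1.integrable_coeFn f) (L1.integrable_coeFn g)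

theorem dilationL1_toL1 (τ : ℝ) {f : ℝ → ℝ} (hf : Integrable f) :
    dilationL1 τ (hf.toL1 f) = (integrable_dilation τ hf).toL1 (dilation τ f) := by
  rw [dilationL1, Integrable.toL1_eq_toL1_iff]
  exact dilation_congr_ae τ hf.coeFn_toL1

theorem exists_norm_le_div_one_add_sq {g : ℝ → ℝ} (hc : Continuous g)
    (hs : HasCompactSupport g) : ∃ C, ∀ x, ‖g x‖ ≤ C * (1 + x ^ 2)⁻¹ := by
  obtain ⟨C, hC⟩ := hs.mul_right (f' := fun x => 1 + x ^ 2) |>.exists_bound_of_continuous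
    (hc.mul (by fun_prop))
  refine ⟨C, fun x => ?_⟩
  have hpos : 0 < 1 + x ^ 2 := by positivity
  rw [← div_eq_mul_inv, le_div_iff₀ hpos]
  simpa only [Pi.mul_apply, norm_mul, Real.norm_of_nonneg hpos.le] using hC x

theorem norm_dilation_le_of_mem_Icc {g : ℝ → ℝ} {C : ℝ}
    (hg : ∀ x, ‖g x‖ ≤ C * (1 + x ^ 2)⁻¹) {a b σ : ℝ} (hσ : σ ∈ Icc a b) (x : ℝ) :
    ‖dilation σ g x‖ ≤ Real.exp b * (C * (1 + (Real.exp a * x) ^ 2)⁻¹) := by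
  have hC : 0 ≤ C := by simpa using (norm_nonneg _).trans (hg 0)
  refine (norm_indicator_le_norm_self _ x).trans ?_
  rw [norm_mul, Real.norm_of_nonneg (Real.exp_nonneg σ)]
  refine mul_le_mul (Real.exp_le_exp.2 hσ.2) ((hg _).trans ?_) (norm_nonneg _)
    (Real.exp_nonneg b)
  rw [mul_pow, mul_pow]
  gcongr
  exact hσ.1

theorem continuous_dilation_apply {g : ℝ → ℝ} (hc : Continuous g) (x : ℝ) :
    Continuous fun τ => dilation τ g x := by
  by_cases hx : x ∈ Ici (1 : ℝ)
  · simp only [dilation, indicator_of_mem hx]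
    fun_prop
  · simpa only [dilation, indicator_of_notMem hx] using continuous_const

theorem continuous_dilationL1_toL1 {g : ℝ → ℝ} (hc : Continuous g) (hs : HasCompactSupport g)
    (hg : Integrable g) : Continuous fun τ => dilationL1 τ (hg.toL1 g) := by
  obtain ⟨C, hC⟩ := exists_norm_le_div_one_add_sq hc hs
  refine continuous_iff_continuousAt.2 fun τ => tendsto_iff_dist_tendsto_zero.2 ?_
  simp only [dilationL1_toL1, dist_toL1]
  rw [← integral_zero ℝ ℝ]
  refine tendsto_integral_filter_of_dominated_convergence
    (fun x => Real.exp (τ + 1) * (C * (1 + (Real.exp (τ - 1) * x) ^ 2)⁻¹) + ‖dilation τ g x‖)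
    (Eventually.of_forall fun σ =>
      ((integrable_dilation σ hg).sub (integrable_dilation τ hg)).norm.aestronglyMeasurable)
    ?_ ?_ (ae_of_all _ fun x =>
      tendsto_iff_norm_sub_tendsto_zero.1 ((continuous_dilation_apply hc x).tendsto τ))
  · filter_upwards [Icc_mem_nhds (sub_one_lt τ) (lt_add_one τ)] with σ hσ
    refine ae_of_all _ fun x => ?_
    rw [norm_norm]
    grw [norm_sub_le, norm_dilation_le_of_mem_Icc hC hσ]
  · exact (((integrable_inv_one_add_sq.comp_mul_left' (Real.exp_ne_zero _)).const_mul
      C).const_mul _).add (integrable_dilation τ hg).norm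

theorem continuous_dilationL1 (f : L1R) : Continuous fun τ => dilationL1 τ f := by
  refine continuous_of_uniform_approx_of_continuous fun u hu => ?_
  obtain ⟨ε, hε, hεu⟩ := Metric.mem_uniformity_dist.1 hu
  obtain ⟨g, hs, hfg, hc, hg⟩ :=
    (L1.integrable_coeFn f).exists_hasCompactSupport_integral_sub_le (half_pos hε)
  refine ⟨_, continuous_dilationL1_toL1 hc hs hg, fun τ => hεu ?_⟩
  calc dist (dilationL1 τ f) (dilationL1 τ (hg.toL1 g)) ≤ dist f (hg.toL1 g) :=
        dist_dilationL1_le τ f _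
    _ = ∫ x, ‖f x - g x‖ := by rw [← dist_toL1 (L1.integrable_coeFn f), Integrable.toL1_coeFn]
    _ < ε := hfg.trans_lt (half_lt_self hε)

theorem continuous_dilationL1_uncurry : Continuous fun q : ℝ × L1R => dilationL1 q.1 q.2 :=
  continuous_prod_of_continuous_lipschitzWith' _ 1
    (fun τ => LipschitzWith.of_dist_le_mul fun f g => by
      simpa using dist_dilationL1_le τ f g)
    continuous_dilationL1

/-- The function `e^{-iζx} f(x)`, whose integral over `(1, ∞)` is `fourier f ζ`. -/
def expMul (ζ : ℂ) (f : ℝ → ℝ) (x : ℝ) : ℂ :=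
  Complex.exp (-Complex.I * ζ * x) * f x

theorem norm_expMul (ζ : ℂ) (f : ℝ → ℝ) (x : ℝ) :
    ‖expMul ζ f x‖ = Real.exp (ζ.im * x) * ‖f x‖ := by
  simp [expMul, Complex.norm_exp]

theorem norm_expMul_le {ζ : ℂ} (hζ : ζ.im ≤ 0) (f : ℝ → ℝ) {a x : ℝ} (hx : a ≤ x) :
    ‖expMul ζ f x‖ ≤ Real.exp (ζ.im * a) * ‖f x‖ := by
  rw [norm_expMul]
  gcongr ?_ * _
  exact Real.exp_le_exp.2 (mul_le_mul_of_nonpos_left hx hζ)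

theorem expMul_neg_mul_I (ε : ℝ) (f : ℝ → ℝ) (x : ℝ) :
    expMul (-(ε * Complex.I)) f x = (Real.exp (-ε * x) * f x : ℝ) := by
  have hexponent : -Complex.I * -(ε * Complex.I) * x = ((-ε * x : ℝ) : ℂ) := by
    push_cast
    linear_combination (ε * x : ℂ) * Complex.I_mul_I
  rw [expMul, hexponent, ← Complex.ofReal_exp, ← Complex.ofReal_mul]

theorem integrableOn_expMul {ζ : ℂ} (hζ : ζ.im ≤ 0) {a : ℝ} {f : ℝ → ℝ}
    (hf : IntegrableOn f (Ioi a)) : IntegrableOn (expMul ζ f) (Ioi a) := by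
  have hcont : Continuous fun x : ℝ => Complex.exp (-Complex.I * ζ * x) := by fun_prop
  refine (hf.norm.const_mul (Real.exp (ζ.im * a))).mono'
    (hcont.aestronglyMeasurable.mul hf.ofReal.aestronglyMeasurable) ?_
  filter_upwards [ae_restrict_mem measurableSet_Ioi] with x hx using norm_expMul_le hζ f hx.le

/-- The Fourier transform truncated to the half line `(a, ∞)`. -/
def truncFourier (a : ℝ) (ζ : ℂ) (f : ℝ → ℝ) : ℂ :=
  ∫ x in Ioi a, expMul ζ f x

theorem truncFourier_one (ζ : ℂ) (f : ℝ → ℝ) : truncFourier 1 ζ f = fourier f ζ := rfl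

theorem truncFourier_congr_ae (a : ℝ) (ζ : ℂ) {f g : ℝ → ℝ} (h : f =ᵐ[volume] g) :
    truncFourier a ζ f = truncFourier a ζ g := by
  refine integral_congr_ae (ae_restrict_of_ae ?_)
  filter_upwards [h] with x hx
  rw [expMul, expMul, hx]

theorem norm_truncFourier_le {a : ℝ} {ζ : ℂ} (hζ : ζ.im ≤ 0) {f : ℝ → ℝ}
    (hf : IntegrableOn f (Ioi a)) :
    ‖truncFourier a ζ f‖ ≤ Real.exp (ζ.im * a) * ∫ x in Ioi a, ‖f x‖ := by
  rw [← integral_const_mul]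
  refine norm_integral_le_of_norm_le (hf.norm.const_mul _) ?_
  filter_upwards [ae_restrict_mem measurableSet_Ioi] with x hx using norm_expMul_le hζ f hx.le

theorem norm_fourier_le {f : L1R} (hf : f ∈ probDensities) {ζ : ℂ} (hζ : ζ.im ≤ 0) :
    ‖fourier f ζ‖ ≤ Real.exp ζ.im := by
  have hle := norm_truncFourier_le (a := 1) hζ (L1.integrable_coeFn f).integrableOn
  have hnorm : (fun x => ‖f x‖) =ᵐ[volume] f :=
    hf.2.1.mono fun x hx => Real.norm_of_nonneg hx
  rwa [integral_congr_ae (ae_restrict_of_ae hnorm), hf.2.2, mul_one, mul_one] at hle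

/-- The truncated Fourier transform as a bounded functional on `L¹(ℝ)`. -/
def truncFourierCLM (a : ℝ) {ζ : ℂ} (hζ : ζ.im ≤ 0) : L1R →L[ℝ] ℂ :=
  LinearMap.mkContinuous
    { toFun := fun f => truncFourier a ζ f
      map_add' := fun f g => by
        rw [truncFourier_congr_ae a ζ (Lp.coeFn_add f g), truncFourier, truncFourier,
          truncFourier,
          ← integral_add (integrableOn_expMul hζ (L1.integrable_coeFn f).integrableOn)
            (integrableOn_expMul hζ (L1.integrable_coeFn g).integrableOn)]
        simp only [expMul, Pi.add_apply, Complex.ofReal_add, mul_add]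
      map_smul' := fun c f => by
        rw [truncFourier_congr_ae a ζ (Lp.coeFn_smul c f), truncFourier, truncFourier,
          ← integral_smul]
        simp only [expMul, Pi.smul_apply, smul_eq_mul, Complex.ofReal_mul, RingHom.id_apply,
          Complex.real_smul, mul_left_comm] }
    (Real.exp (ζ.im * a)) fun f => by
      rw [L1.norm_eq_integral_norm]
      exact (norm_truncFourier_le hζ (L1.integrable_coeFn f).integrableOn).trans <| by
        gcongr
        · exact ae_of_all _ fun x => norm_nonneg _
        · exact (L1.integrable_coeFn f).norm
        · exact Measure.restrict_le_self

theorem truncFourierCLM_apply (a : ℝ) {ζ : ℂ} (hζ : ζ.im ≤ 0) (f : L1R) :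
    truncFourierCLM a hζ f = truncFourier a ζ f := rfl

theorem truncFourier_dilation {a : ℝ} (ha : 1 ≤ a) (σ : ℝ) (ζ : ℂ) (f : ℝ → ℝ) :
    truncFourier a (Real.exp σ * ζ) (dilation σ f) = truncFourier (Real.exp σ * a) ζ f := by
  calc truncFourier a (Real.exp σ * ζ) (dilation σ f)
      = ∫ x in Ioi a, Real.exp σ • expMul ζ f (Real.exp σ * x) := by
        refine setIntegral_congr_fun measurableSet_Ioi fun x hx => ?_
        simp only [expMul, dilation, indicator_of_mem (mem_Ici.2 (ha.trans hx.le)),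
          Complex.ofReal_mul, Complex.real_smul]
        ring_nf
    _ = truncFourier (Real.exp σ * a) ζ f := by
        rw [integral_smul, integral_comp_mul_left_Ioi _ _ (Real.exp_pos σ),
          smul_inv_smul₀ (Real.exp_ne_zero σ), truncFourier]

theorem fourier_dilation_zero (f : ℝ → ℝ) : fourier (dilation 0 f) = fourier f := by
  ext ζ
  refine setIntegral_congr_fun measurableSet_Ioi fun x hx => ?_
  simp only [dilation, indicator_of_mem (Ioi_subset_Ici_self hx), Real.exp_zero, one_mul]

theorem ae_notMem_Ioi_imp_eq_zero {E : Type*} [Zero E] {f : ℝ → E} {a b : ℝ} (hab : a ≤ b)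
    (hf : ∀ᵐ x, x < b → f x = 0) : ∀ᵐ x, x ∉ Ioi a → f x = 0 := by
  filter_upwards [hf, Measure.ae_ne volume b] with x hx hxb hxa
  exact hx (lt_of_le_of_ne ((not_lt.1 hxa).trans hab) hxb)

theorem truncFourier_eq_integral {a b : ℝ} (hab : a ≤ b) (ζ : ℂ) {f : ℝ → ℝ}
    (hf : ∀ᵐ x, x < b → f x = 0) : truncFourier a ζ f = ∫ x, expMul ζ f x := by
  refine setIntegral_eq_integral_of_ae_compl_eq_zero ?_
  filter_upwards [ae_notMem_Ioi_imp_eq_zero hab hf] with x hx hxa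
  rw [expMul, hx hxa, Complex.ofReal_zero, mul_zero]

theorem integrable_expMul {ζ : ℂ} (hζ : ζ.im ≤ 0) {b : ℝ} {f : ℝ → ℝ} (hf : Integrable f)
    (hf0 : ∀ᵐ x, x < b → f x = 0) : Integrable (expMul ζ f) := by
  refine (integrableOn_expMul hζ hf.integrableOn).integrable_of_ae_notMem_eq_zero (s := Ioi b) ?_
  filter_upwards [ae_notMem_Ioi_imp_eq_zero le_rfl hf0] with x hx hxa
  rw [expMul, hx hxa, Complex.ofReal_zero, mul_zero]

theorem convolution_expMul (ζ : ℂ) (f g : ℝ → ℝ) :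
    convolution (expMul ζ f) (expMul ζ g) (ContinuousLinearMap.mul ℝ ℂ) volume =
      expMul ζ (convolution f g (ContinuousLinearMap.mul ℝ ℝ) volume) := by
  ext x
  simp only [convolution, ContinuousLinearMap.mul_apply', expMul]
  rw [← integral_complex_ofReal, ← integral_const_mul]
  congr 1 with t
  have hexp : Complex.exp (-Complex.I * ζ * x) =
      Complex.exp (-Complex.I * ζ * t) * Complex.exp (-Complex.I * ζ * (x - t : ℝ)) := by
    rw [← Complex.exp_add, ← mul_add, Complex.ofReal_sub, add_sub_cancel]
  rw [hexp, Complex.ofReal_mul, mul_mul_mul_comm]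

theorem hasIntegral_expMul_convPow {ζ : ℂ} {f : ℝ → ℝ} (h : Integrable (expMul ζ f)) :
    ∀ j : ℕ, Integrable (expMul ζ (convPow f (j + 1))) ∧
      ∫ x, expMul ζ (convPow f (j + 1)) x = (∫ x, expMul ζ f x) ^ (j + 1)
  | 0 => ⟨h, (pow_one _).symm⟩
  | j + 1 => by
    obtain ⟨hint, hpow⟩ := hasIntegral_expMul_convPow h j
    rw [convPow, ← convolution_expMul]
    refine ⟨h.integrable_convolution _ hint, ?_⟩
    rw [integral_convolution _ h hint, hpow, ContinuousLinearMap.mul_apply', ← pow_succ']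

theorem integral_expMul_Qconv (N : ℕ) (p : ℕ → ℝ) {ζ : ℂ} {f : ℝ → ℝ}
    (h : Integrable (expMul ζ f)) :
    ∫ x, expMul ζ (Qconv N p f) x = Qpoly N p (∫ x, expMul ζ f x) := by
  have hterm : ∀ j ∈ Finset.Icc 1 N, Integrable (expMul ζ (convPow f j)) ∧
      ∫ x, expMul ζ (convPow f j) x = (∫ x, expMul ζ f x) ^ j := by
    intro j hj
    obtain ⟨k, rfl⟩ := Nat.exists_eq_add_of_le' (Finset.mem_Icc.1 hj).1
    exact hasIntegral_expMul_convPow h k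
  calc ∫ x, expMul ζ (Qconv N p f) x
      = ∫ x, ∑ j ∈ Finset.Icc 1 N, p j * expMul ζ (convPow f j) x := by
        simp only [expMul, Qconv, Complex.ofReal_sum, Complex.ofReal_mul, Finset.mul_sum,
          mul_left_comm]
    _ = Qpoly N p (∫ x, expMul ζ f x) := by
        rw [integral_finsetSum _ fun j hj => (hterm j hj).1.const_mul _]
        exact Finset.sum_congr rfl fun j hj => by rw [integral_const_mul, (hterm j hj).2]

theorem convolution_eq_zero_of_ae_lt {f g : ℝ → ℝ} {a b x : ℝ} (hf : ∀ᵐ t, t < a → f t = 0)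
    (hg : ∀ᵐ t, t < b → g t = 0) (hx : x < a + b) :
    convolution f g (ContinuousLinearMap.mul ℝ ℝ) volume x = 0 := by
  refine integral_eq_zero_of_ae ?_
  filter_upwards [hf, (quasiMeasurePreserving_sub_left volume x).ae hg] with t hft hgt
  rw [ContinuousLinearMap.mul_apply']
  rcases lt_or_ge t a with hta | hta
  · rw [hft hta, zero_mul, Pi.zero_apply]
  · rw [hgt (by linarith), mul_zero, Pi.zero_apply]

theorem convPow_ae_eq_zero {f : ℝ → ℝ} {a : ℝ} (hf : ∀ᵐ x, x < a → f x = 0) :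
    ∀ j : ℕ, ∀ᵐ x, x < j * a → convPow f j x = 0
  | 0 => ae_of_all _ fun _ _ => rfl
  | 1 => by simpa only [Nat.cast_one, one_mul, convPow] using hf
  | j + 2 => by
    refine ae_of_all _ fun x hx =>
      convolution_eq_zero_of_ae_lt hf (convPow_ae_eq_zero hf (j + 1)) ?_
    push_cast at hx ⊢
    linarith

theorem Qconv_ae_eq_zero (N : ℕ) (p : ℕ → ℝ) {f : ℝ → ℝ} {a : ℝ} (ha : 0 ≤ a)
    (hf : ∀ᵐ x, x < a → f x = 0) : ∀ᵐ x, x < a → Qconv N p f x = 0 := by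
  filter_upwards [ae_all_iff.2 (convPow_ae_eq_zero hf)] with x hx hxa
  refine Finset.sum_eq_zero fun j hj => ?_
  have hj : (1 : ℝ) ≤ j := Nat.one_le_cast.2 (Finset.mem_Icc.1 hj).1
  rw [hx j (hxa.trans_le (le_mul_of_one_le_left ha hj)), mul_zero]

theorem shiftOne_ae_eq {f : ℝ → ℝ} (hf : ∀ᵐ x, x < 1 → f x = 0) :
    shiftOne f =ᵐ[volume] fun x => f (x - 1) := by
  filter_upwards [(measurePreserving_sub_right volume (1 : ℝ)).quasiMeasurePreserving.ae hf]
    with x hx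
  refine indicator_apply_eq_self.2 fun hx2 => hx ?_
  linarith [not_le.1 (mem_Ici.not.1 hx2)]

theorem integral_expMul_comp_sub_right (ζ : ℂ) (f : ℝ → ℝ) (c : ℝ) :
    ∫ x, expMul ζ (fun x => f (x - c)) x =
      Complex.exp (-Complex.I * ζ * c) * ∫ x, expMul ζ f x := by
  rw [← integral_const_mul, ← integral_sub_right_eq_self (fun x : ℝ =>
    Complex.exp (-Complex.I * ζ * c) * expMul ζ f x) c]
  congr 1 with x
  rw [expMul, expMul, ← mul_assoc, ← Complex.exp_add, ← mul_add, Complex.ofReal_sub,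
    add_sub_cancel]

theorem truncFourier_shiftQconvL1 (N : ℕ) (p : ℕ → ℝ) {a : ℝ} (ha : a ≤ 2) {ζ : ℂ}
    (hζ : ζ.im ≤ 0) {f : L1R} (hf : ∀ᵐ x, x < 1 → f x = 0) :
    truncFourier a ζ (shiftQconvL1 N p f) =
      Complex.exp (-Complex.I * ζ) * Qpoly N p (fourier f ζ) := by
  have hsupp : ∀ᵐ x, x < 2 → shiftOne (Qconv N p f) x = 0 :=
    ae_of_all _ fun x hx => indicator_of_notMem (not_le.2 hx) _
  have hshift := shiftOne_ae_eq (Qconv_ae_eq_zero N p zero_le_one hf)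
  calc truncFourier a ζ (shiftQconvL1 N p f)
      = ∫ x, expMul ζ (shiftOne (Qconv N p f)) x := by
        rw [shiftQconvL1, truncFourier_congr_ae _ _ (Integrable.coeFn_toL1 _),
          truncFourier_eq_integral ha ζ hsupp]
    _ = ∫ x, expMul ζ (fun x => Qconv N p f (x - 1)) x := by
        refine integral_congr_ae ?_
        filter_upwards [hshift] with x hx
        rw [expMul, expMul, hx]
    _ = Complex.exp (-Complex.I * ζ) * Qpoly N p (fourier f ζ) := by
        rw [integral_expMul_comp_sub_right, Complex.ofReal_one, mul_one,
          integral_expMul_Qconv N p (integrable_expMul hζ (L1.integrable_coeFn f) hf),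
          ← truncFourier_eq_integral le_rfl ζ hf, truncFourier_one]

theorem hasDerivAt_exp_sub (τ s : ℝ) :
    HasDerivAt (fun s => Real.exp (s - τ)) (Real.exp (s - τ)) s := by
  simpa using ((hasDerivAt_id s).sub_const τ).exp

theorem injective_exp_sub (τ : ℝ) : Function.Injective fun s => Real.exp (s - τ) :=
  Real.exp_injective.comp sub_left_injective

theorem image_exp_sub_Ioc (τ a b : ℝ) :
    (fun s => Real.exp (s - τ)) '' Ioc a b = Ioc (Real.exp (a - τ)) (Real.exp (b - τ)) := by
  ext x
  refine ⟨?_, fun hx => ?_⟩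
  · rintro ⟨s, hs, rfl⟩
    exact ⟨Real.exp_lt_exp.2 (sub_lt_sub_right hs.1 τ), Real.exp_le_exp.2 (sub_le_sub_right hs.2 τ)⟩
  · have hx0 : 0 < x := (Real.exp_pos _).trans hx.1
    have hlower := (Real.lt_log_iff_exp_lt hx0).2 hx.1
    have hupper := (Real.log_le_iff_le_exp hx0).2 hx.2
    exact ⟨Real.log x + τ, ⟨by linarith, by linarith⟩, by simp [Real.exp_log hx0]⟩

theorem image_exp_sub_Ioi (τ a : ℝ) :
    (fun s => Real.exp (s - τ)) '' Ioi a = Ioi (Real.exp (a - τ)) := by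
  ext x
  refine ⟨?_, fun hx => ?_⟩
  · rintro ⟨s, hs, rfl⟩
    exact Real.exp_lt_exp.2 (sub_lt_sub_right hs τ)
  · have hx0 : 0 < x := (Real.exp_pos _).trans hx
    have hlower := (Real.lt_log_iff_exp_lt hx0).2 hx
    exact ⟨Real.log x + τ, sub_lt_iff_lt_add.1 hlower, by simp [Real.exp_log hx0]⟩

theorem ae_comp_exp_sub {P : ℝ → Prop} (h : ∀ᵐ x, P x) (τ : ℝ) :
    ∀ᵐ s, P (Real.exp (s - τ)) := by
  have himage : volume ((fun x => Real.log x + τ) '' ({x | ¬P x} ∩ Ioi 0)) = 0 :=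
    addHaar_image_eq_zero_of_differentiableOn_of_addHaar_eq_zero volume
      (fun x hx => ((Real.differentiableAt_log (ne_of_gt hx.2)).add_const
        τ).differentiableWithinAt) (measure_mono_null inter_subset_left h)
  have hsubset : {s | ¬P (Real.exp (s - τ))} ⊆
      (fun x => Real.log x + τ) '' ({x | ¬P x} ∩ Ioi 0) :=
    fun s hs => ⟨Real.exp (s - τ), ⟨hs, Real.exp_pos _⟩, by simp⟩
  exact measure_mono_null hsubset himage

/-- The function `β(s) e^{-i e^s ξ}`. For a trace `β`, it is the integrand of the Fourier transform
of the solution along the characteristic `s ↦ e^s ξ`, after the substitution `x = e^s`. -/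
def traceKernel (β : ℝ → ℝ) (ξ : ℂ) (s : ℝ) : ℂ :=
  β s * Complex.exp (-Complex.I * (Real.exp s * ξ))

section ChangeOfVariables

variable {β f : ℝ → ℝ} {τ : ℝ} {S : Set ℝ}

theorem exp_smul_expMul_ae_eq_traceKernel (hS : MeasurableSet S)
    (h : ∀ᵐ s, s ∈ S → β s = Real.exp (s - τ) * f (Real.exp (s - τ))) (ξ : ℂ) :
    (fun s => |Real.exp (s - τ)| • expMul (Real.exp τ * ξ) f (Real.exp (s - τ)))
      =ᵐ[volume.restrict S] traceKernel β ξ := by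
  filter_upwards [ae_restrict_mem hS, ae_restrict_of_ae h] with s hs hβ
  have hexp : -Complex.I * (Real.exp τ * ξ) * Real.exp (s - τ) =
      -Complex.I * (Real.exp s * ξ) := by
    have hmul : (Real.exp τ : ℂ) * Real.exp (s - τ) = Real.exp s := by
      rw [← Complex.ofReal_mul, ← Real.exp_add, add_sub_cancel]
    linear_combination (-Complex.I * ξ) * hmul
  rw [traceKernel, hβ hs, expMul, hexp, Real.abs_exp, Complex.real_smul, Complex.ofReal_mul]
  ring

theorem setIntegral_image_exp_sub (hS : MeasurableSet S)
    (h : ∀ᵐ s, s ∈ S → β s = Real.exp (s - τ) * f (Real.exp (s - τ))) (ξ : ℂ) :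
    ∫ x in (fun s => Real.exp (s - τ)) '' S, expMul (Real.exp τ * ξ) f x =
      ∫ s in S, traceKernel β ξ s := by
  rw [integral_image_eq_integral_abs_deriv_smul hS
    (fun s _ => (hasDerivAt_exp_sub τ s).hasDerivWithinAt) (injective_exp_sub τ).injOn]
  exact integral_congr_ae (exp_smul_expMul_ae_eq_traceKernel hS h ξ)

theorem integrableOn_image_exp_sub_iff (hS : MeasurableSet S)
    (h : ∀ᵐ s, s ∈ S → β s = Real.exp (s - τ) * f (Real.exp (s - τ))) (ξ : ℂ) :
    IntegrableOn (expMul (Real.exp τ * ξ) f) ((fun s => Real.exp (s - τ)) '' S) ↔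
      IntegrableOn (traceKernel β ξ) S := by
  rw [integrableOn_image_iff_integrableOn_abs_deriv_smul hS
    (fun s _ => (hasDerivAt_exp_sub τ s).hasDerivWithinAt) (injective_exp_sub τ).injOn]
  exact integrable_congr (exp_smul_expMul_ae_eq_traceKernel hS h ξ)

end ChangeOfVariables

theorem exp_mul_im (s : ℝ) (ξ : ℂ) : ((Real.exp s : ℂ) * ξ).im = Real.exp s * ξ.im :=
  Complex.im_ofReal_mul _ _

theorem exp_mul_im_nonpos (s : ℝ) {ξ : ℂ} (hξ : ξ.im ≤ 0) : ((Real.exp s : ℂ) * ξ).im ≤ 0 :=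
  (exp_mul_im s ξ).trans_le (mul_nonpos_of_nonneg_of_nonpos (Real.exp_nonneg s) hξ)

namespace IsTrace

variable {η : ℝ → L1R} {β : ℝ → ℝ}

theorem intervalIntegrable (h : IsTrace η β) {a b : ℝ} (ha : 0 ≤ a) (hb : 0 ≤ b) :
    IntervalIntegrable β volume a b := by
  have hzero : ∀ t, 0 ≤ t → IntervalIntegrable β volume 0 t := by
    refine forall_nonneg_of_step (Real.log_pos one_lt_two) .refl fun s t hs hst ht ih =>
      ih.trans ?_
    have hβ : ∀ᵐ u, u ∈ Ioc s t → β u = Real.exp (u - s) * η s (Real.exp (u - s)) := by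
      filter_upwards [h s hs] with u hu hmem using hu ⟨hmem.1.le, hmem.2.trans ht⟩
    have hηs : Integrable fun x => expMul (Real.exp s * 0) (η s) x := by
      simpa [expMul] using (L1.integrable_coeFn (η s)).ofReal (𝕜 := ℂ)
    have hkernel := (integrableOn_image_exp_sub_iff measurableSet_Ioc hβ 0).1 hηs.integrableOn
    rw [intervalIntegrable_iff_integrableOn_Ioc_of_le hst]
    simpa [traceKernel, IntegrableOn] using hkernel.re
  exact (hzero a ha).symm.trans (hzero b hb)

theorem intervalIntegrable_traceKernel (h : IsTrace η β) (ξ : ℂ) {a b : ℝ} (ha : 0 ≤ a)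
    (hb : 0 ≤ b) : IntervalIntegrable (traceKernel β ξ) volume a b := by
  have hβ := h.intervalIntegrable ha hb
  exact IntervalIntegrable.mul_continuousOn ⟨hβ.1.ofReal, hβ.2.ofReal⟩ (by fun_prop)

theorem ae_nonneg (h : IsTrace η β) (hη : ∀ τ, 0 ≤ τ → ∀ᵐ x, 0 ≤ η τ x) :
    ∀ᵐ s, 0 ≤ s → 0 ≤ β s := by
  have hIcc : ∀ t, 0 ≤ t → ∀ᵐ s, s ∈ Icc 0 t → 0 ≤ β s := by
    refine forall_nonneg_of_step (Real.log_pos one_lt_two) ?_ fun τ t hτ _ ht ih => ?_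
    · filter_upwards [Measure.ae_ne volume (0 : ℝ)] with s hs hs0
      exact absurd (le_antisymm hs0.2 hs0.1) hs
    · filter_upwards [ih, h τ hτ, ae_comp_exp_sub (hη τ hτ) τ] with s hbefore hβ hηs hs
      rcases le_total s τ with hsτ | hτs
      · exact hbefore ⟨hs.1, hsτ⟩
      · rw [hβ ⟨hτs, hs.2.trans ht⟩]
        exact mul_nonneg (Real.exp_nonneg _) hηs
  filter_upwards [ae_all_iff.2 fun n : ℕ => hIcc n n.cast_nonneg] with s hs hs0
  exact hs ⌈s⌉₊ ⟨hs0, Nat.le_ceil s⟩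

theorem fourier_sub_truncFourier (h : IsTrace η β) {τ t : ℝ} (hτ : 0 ≤ τ) (hτt : τ ≤ t)
    (ht : t ≤ τ + Real.log 2) {ξ : ℂ} (hξ : ξ.im ≤ 0) :
    fourier (η τ) (Real.exp τ * ξ) -
        truncFourier (Real.exp (t - τ)) (Real.exp τ * ξ) (η τ) =
      ∫ s in τ..t, traceKernel β ξ s := by
  have hβ : ∀ᵐ s, s ∈ Ioc τ t → β s = Real.exp (s - τ) * η τ (Real.exp (s - τ)) := by
    filter_upwards [h τ hτ] with s hs hmem using hs ⟨hmem.1.le, hmem.2.trans ht⟩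
  have hint {a : ℝ} := integrableOn_expMul (a := a) (exp_mul_im_nonpos τ hξ)
    (L1.integrable_coeFn (η τ)).integrableOn
  rw [intervalIntegral.integral_of_le hτt, ← setIntegral_image_exp_sub measurableSet_Ioc hβ,
    image_exp_sub_Ioc, sub_self, Real.exp_zero,
    ← intervalIntegral.integral_of_le (Real.one_le_exp (sub_nonneg.2 hτt)),
    ← intervalIntegral.integral_Ioi_sub_Ioi hint (Real.one_le_exp (sub_nonneg.2 hτt))]
  rfl

end IsTrace

theorem ofReal_norm_traceKernel {β : ℝ → ℝ} {s : ℝ} (hβ : 0 ≤ β s) (ξ : ℂ) :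
    (‖traceKernel β ξ s‖ : ℂ) = traceKernel β (ξ.im * Complex.I) s := by
  have hre : (-Complex.I * (Real.exp s * ξ)).re = Real.exp s * ξ.im := by
    rw [← exp_mul_im]
    simp only [neg_mul, Complex.neg_re, Complex.I_mul_re, neg_neg]
  have hexponent : -Complex.I * (Real.exp s * (ξ.im * Complex.I)) = (Real.exp s * ξ.im : ℝ) := by
    push_cast
    linear_combination (-(Complex.exp s) * ξ.im) * Complex.I_mul_I
  rw [traceKernel, traceKernel, norm_mul, Complex.norm_exp, hre, hexponent,
    Complex.norm_of_nonneg hβ, Complex.ofReal_mul, Complex.ofReal_exp]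

/-- The Fourier transform of `η` along the characteristic `s ↦ e^s ξ`. -/
def fourierAlong (η : ℝ → L1R) (ξ : ℂ) (s : ℝ) : ℂ :=
  fourier (η s) (Real.exp s * ξ)

/-- A solution in the sense of `IsSolution`, together with a choice `β` of its trace. -/
structure IsSolutionWithTrace (N : ℕ) (p : ℕ → ℝ) (η₀ : L1R) (η : ℝ → L1R) (β : ℝ → ℝ) : Prop
    extends IsSolution N p η₀ η where
  isTrace : IsTrace η β
  eq_dilationL1_add_integral : ∀ τ : ℝ, 0 ≤ τ →
    η τ = dilationL1 τ η₀ + ∫ s in (0 : ℝ)..τ, β s • dilationL1 (τ - s) (shiftQconvL1 N p (η s))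

section Solution

variable {N : ℕ} {p : ℕ → ℝ} {η₀ : L1R} {η : ℝ → L1R} {β : ℝ → ℝ}

theorem IsSolution.exists_isSolutionWithTrace (h : IsSolution N p η₀ η) :
    ∃ β, IsSolutionWithTrace N p η₀ η β :=
  let ⟨β, hβ, heq⟩ := h.integral_eq
  ⟨β, h, hβ, heq⟩

theorem IsSolution.norm_fourierAlong_le (h : IsSolution N p η₀ η) {s : ℝ} (hs : 0 ≤ s) {ξ : ℂ}
    (hξ : ξ.im ≤ 0) : ‖fourierAlong η ξ s‖ ≤ Real.exp (Real.exp s * ξ.im) := by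
  simpa only [fourierAlong, exp_mul_im] using norm_fourier_le (h.mem s hs) (exp_mul_im_nonpos s hξ)

theorem IsSolution.norm_fourierAlong_lt_one (h : IsSolution N p η₀ η) {s : ℝ} (hs : 0 ≤ s)
    {ξ : ℂ} (hξ : ξ.im < 0) : ‖fourierAlong η ξ s‖ < 1 :=
  (h.norm_fourierAlong_le hs hξ.le).trans_lt <|
    Real.exp_lt_one_iff.2 (mul_neg_of_pos_of_neg (Real.exp_pos s) hξ)

theorem IsSolution.tendsto_fourierAlong (h : IsSolution N p η₀ η) {ξ : ℂ} (hξ : ξ.im < 0) :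
    Tendsto (fourierAlong η ξ) atTop (𝓝 0) := by
  refine squeeze_zero_norm' ?_ <|
    Real.tendsto_exp_atBot.comp (Real.tendsto_exp_atTop.atTop_mul_const_of_neg hξ)
  filter_upwards [eventually_ge_atTop 0] with s hs using h.norm_fourierAlong_le hs hξ.le

theorem truncFourier_dilationL1_sub {τ c : ℝ} (hc : τ ≤ c) (s : ℝ) (ξ : ℂ) (f : L1R) :
    truncFourier (Real.exp (c - τ)) (Real.exp τ * ξ) (dilationL1 (τ - s) f) =
      truncFourier (Real.exp (c - s)) (Real.exp s * ξ) f := by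
  have hfrequency : (Real.exp τ * ξ : ℂ) = Real.exp (τ - s) * (Real.exp s * ξ) := by
    rw [← mul_assoc, ← Complex.ofReal_mul, ← Real.exp_add, sub_add_cancel]
  rw [dilationL1, truncFourier_congr_ae _ _ (Integrable.coeFn_toL1 _), hfrequency,
    truncFourier_dilation (Real.one_le_exp (sub_nonneg.2 hc)), ← Real.exp_add, add_comm,
    sub_add_sub_cancel]

namespace IsSolutionWithTrace

variable (h : IsSolutionWithTrace N p η₀ η β)
include h

theorem intervalIntegrable_dilationL1 {τ : ℝ} (hτ : 0 ≤ τ) :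
    IntervalIntegrable (fun s => β s • dilationL1 (τ - s) (shiftQconvL1 N p (η s)))
      volume 0 τ := by
  refine (h.isTrace.intervalIntegrable le_rfl hτ).smul_continuousOn ?_
  rw [uIcc_of_le hτ]
  exact continuous_dilationL1_uncurry.comp_continuousOn <|
    (continuousOn_const.sub continuousOn_id).prodMk <|
      (continuous_shiftQconvL1 N p).comp_continuousOn (h.continuousOn.mono Icc_subset_Ici_self)

theorem truncFourier_eq {τ c : ℝ} (hτ : 0 ≤ τ) (hc : τ ≤ c) {ξ : ℂ} (hξ : ξ.im ≤ 0) :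
    IntervalIntegrable (fun s => β s * truncFourier (Real.exp (c - s)) (Real.exp s * ξ)
        (shiftQconvL1 N p (η s))) volume 0 τ ∧
      truncFourier (Real.exp (c - τ)) (Real.exp τ * ξ) (η τ) =
        truncFourier (Real.exp c) ξ η₀ + ∫ s in (0 : ℝ)..τ,
          β s * truncFourier (Real.exp (c - s)) (Real.exp s * ξ) (shiftQconvL1 N p (η s)) := by
  set Λ := truncFourierCLM (Real.exp (c - τ)) (exp_mul_im_nonpos τ hξ) with hΛ
  have hint := h.intervalIntegrable_dilationL1 hτ
  have hsource (s : ℝ) : Λ (β s • dilationL1 (τ - s) (shiftQconvL1 N p (η s))) =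
      β s * truncFourier (Real.exp (c - s)) (Real.exp s * ξ) (shiftQconvL1 N p (η s)) := by
    rw [map_smul, hΛ, truncFourierCLM_apply, truncFourier_dilationL1_sub hc, Complex.real_smul]
  have hinitial : Λ (dilationL1 τ η₀) = truncFourier (Real.exp c) ξ η₀ := by
    simpa [hΛ, truncFourierCLM_apply] using truncFourier_dilationL1_sub hc 0 ξ η₀
  have hΛη : Λ (η τ) = _ := congrArg Λ (h.eq_dilationL1_add_integral τ hτ)
  rw [map_add, hinitial, ← Λ.intervalIntegral_comp_comm hint] at hΛη
  simp only [hsource] at hΛη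
  have hΛint : IntervalIntegrable
      (fun s => Λ (β s • dilationL1 (τ - s) (shiftQconvL1 N p (η s)))) volume 0 τ :=
    ⟨Λ.integrable_comp hint.1, Λ.integrable_comp hint.2⟩
  exact ⟨by simpa only [hsource] using hΛint, hΛη⟩

theorem truncFourier_shiftQconvL1_eq {s t : ℝ} (hs : 0 ≤ s) (ht : t ≤ s + Real.log 2) {ξ : ℂ}
    (hξ : ξ.im ≤ 0) :
    β s * truncFourier (Real.exp (t - s)) (Real.exp s * ξ) (shiftQconvL1 N p (η s)) =
      traceKernel β ξ s * Qpoly N p (fourierAlong η ξ s) := by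
  have hcutoff : Real.exp (t - s) ≤ 2 :=
    (Real.le_log_iff_exp_le two_pos).1 (sub_le_iff_le_add'.2 ht)
  rw [truncFourier_shiftQconvL1 N p hcutoff (exp_mul_im_nonpos s hξ) (h.mem s hs).1, traceKernel,
    fourierAlong, mul_assoc]

section Step

variable {τ t : ℝ} (hτ : 0 ≤ τ) (hτt : τ ≤ t) (ht : t ≤ τ + Real.log 2) {ξ : ℂ}
include hτ hτt ht

theorem truncFourier_sub_eq (hξ : ξ.im ≤ 0) :
    IntervalIntegrable (fun s => traceKernel β ξ s * Qpoly N p (fourierAlong η ξ s)) volume τ t ∧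
      fourierAlong η ξ t - truncFourier (Real.exp (t - τ)) (Real.exp τ * ξ) (η τ) =
        ∫ s in τ..t, traceKernel β ξ s * Qpoly N p (fourierAlong η ξ s) := by
  obtain ⟨hint_t, heq_t⟩ := h.truncFourier_eq (hτ.trans hτt) le_rfl hξ
  obtain ⟨hint_τ, heq_τ⟩ := h.truncFourier_eq hτ hτt hξ
  rw [sub_self, Real.exp_zero, truncFourier_one] at heq_t
  have hsource : EqOn
      (fun s => β s * truncFourier (Real.exp (t - s)) (Real.exp s * ξ) (shiftQconvL1 N p (η s)))
      (fun s => traceKernel β ξ s * Qpoly N p (fourierAlong η ξ s)) (uIcc τ t) := by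
    rw [uIcc_of_le hτt]
    exact fun s hs =>
      h.truncFourier_shiftQconvL1_eq (hτ.trans hs.1) (ht.trans (by gcongr; exact hs.1)) hξ
  refine ⟨(hint_τ.symm.trans hint_t).congr (hsource.mono uIoc_subset_uIcc), ?_⟩
  rw [fourierAlong, heq_t, heq_τ, add_sub_add_left_eq_sub,
    intervalIntegral.integral_interval_sub_left hint_t hint_τ]
  exact intervalIntegral.integral_congr hsource

theorem fourierAlong_sub_eq (hξ : ξ.im ≤ 0) :
    IntervalIntegrable (fun s => -traceKernel β ξ s * (1 - Qpoly N p (fourierAlong η ξ s)))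
        volume τ t ∧
      fourierAlong η ξ t - fourierAlong η ξ τ =
        ∫ s in τ..t, -traceKernel β ξ s * (1 - Qpoly N p (fourierAlong η ξ s)) := by
  obtain ⟨hsource_int, hsource⟩ := h.truncFourier_sub_eq hτ hτt ht hξ
  have hkernel_int := h.isTrace.intervalIntegrable_traceKernel ξ hτ (hτ.trans hτt)
  have htrace := h.isTrace.fourier_sub_truncFourier hτ hτt ht hξ
  have hexpand : (fun s => -traceKernel β ξ s * (1 - Qpoly N p (fourierAlong η ξ s))) =
      fun s => traceKernel β ξ s * Qpoly N p (fourierAlong η ξ s) - traceKernel β ξ s := by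
    ext s
    ring
  rw [hexpand, intervalIntegral.integral_sub hsource_int hkernel_int, ← hsource, ← htrace]
  exact ⟨hsource_int.sub hkernel_int, by rw [fourierAlong, fourierAlong]; ring⟩

theorem phi_fourierAlong_sub_eq (hQ : ∀ z : ℂ, ‖z‖ < 1 → Qpoly N p z ≠ 1) (hξ : ξ.im < 0) :
    phi N p (fourierAlong η ξ t) - phi N p (fourierAlong η ξ τ) =
      -∫ s in τ..t, traceKernel β ξ s := by
  have hball {s : ℝ} (hs : s ∈ Icc τ t) : fourierAlong η ξ s ∈ Metric.ball 0 1 :=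
    mem_ball_zero_iff.2 (h.norm_fourierAlong_lt_one (hτ.trans hs.1) hξ)
  rw [sub_eq_integral_deriv_mul Metric.isOpen_ball
    (fun z hz => hasDerivAt_phi hQ (mem_ball_zero_iff.1 hz)) hτt
    (h.fourierAlong_sub_eq hτ hτt ht hξ.le).1
    (fun s hs => (h.fourierAlong_sub_eq hτ hs.1 (hs.2.trans ht) hξ.le).2 ▸
      (add_sub_cancel _ _).symm) fun s hs => hball hs, ← intervalIntegral.integral_neg]
  refine intervalIntegral.integral_congr fun s hs => ?_
  rw [uIcc_of_le hτt] at hs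
  have hne : 1 - Qpoly N p (fourierAlong η ξ s) ≠ 0 :=
    sub_ne_zero.2 (hQ _ (mem_ball_zero_iff.1 (hball hs))).symm
  rw [mul_comm, mul_assoc, mul_inv_cancel₀ hne, mul_one]

end Step

variable (hQ : ∀ z : ℂ, ‖z‖ < 1 → Qpoly N p z ≠ 1) {ξ : ℂ} (hξ : ξ.im < 0)
include hQ hξ

theorem phi_fourierAlong_eq {t : ℝ} (ht : 0 ≤ t) :
    phi N p (fourierAlong η ξ t) =
      phi N p (fourierAlong η ξ 0) - ∫ s in (0 : ℝ)..t, traceKernel β ξ s := by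
  refine forall_nonneg_of_step (P := fun t => phi N p (fourierAlong η ξ t) =
    phi N p (fourierAlong η ξ 0) - ∫ s in (0 : ℝ)..t, traceKernel β ξ s)
    (Real.log_pos one_lt_two) (by simp) (fun τ t hτ hτt ht ih => ?_) t ht
  rw [← intervalIntegral.integral_add_adjacent_intervals
    (h.isTrace.intervalIntegrable_traceKernel ξ le_rfl hτ)
    (h.isTrace.intervalIntegrable_traceKernel ξ hτ (hτ.trans hτt))]
  linear_combination ih + h.phi_fourierAlong_sub_eq hτ hτt ht hQ hξ

theorem tendsto_intervalIntegral_traceKernel :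
    Tendsto (fun t => ∫ s in (0 : ℝ)..t, traceKernel β ξ s) atTop
      (𝓝 (phi N p (fourierAlong η ξ 0))) := by
  have hphi : Tendsto (phi N p) (𝓝 0) (𝓝 0) := by
    simpa only [phi_zero] using
      (hasDerivAt_phi hQ (norm_zero.trans_lt one_pos)).continuousAt.tendsto
  have hlim := (hphi.comp (h.tendsto_fourierAlong hξ)).const_sub (phi N p (fourierAlong η ξ 0))
  rw [sub_zero] at hlim
  refine hlim.congr' ?_
  filter_upwards [eventually_ge_atTop 0] with t ht
  rw [Function.comp_apply, h.phi_fourierAlong_eq hQ hξ ht, sub_sub_cancel]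

theorem integrableOn_traceKernel : IntegrableOn (traceKernel β ξ) (Ioi 0) := by
  have hlim := (Complex.continuous_re.tendsto _).comp <|
    h.tendsto_intervalIntegral_traceKernel hQ (ξ := ξ.im * Complex.I) (by simpa using hξ)
  have hint {t : ℝ} (ht : 0 ≤ t) := h.isTrace.intervalIntegrable_traceKernel ξ le_rfl ht
  refine integrableOn_Ioi_of_intervalIntegral_norm_tendsto _ 0 (l := atTop) (b := id)
    (fun t => ?_) tendsto_id (hlim.congr' ?_)
  · rcases le_total 0 t with ht | ht
    · exact (intervalIntegrable_iff_integrableOn_Ioc_of_le ht).1 (hint ht)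
    · simp [Ioc_eq_empty (not_lt.2 ht)]
  · filter_upwards [eventually_ge_atTop 0] with t ht
    have hnorm : ∫ s in (0 : ℝ)..t, traceKernel β (ξ.im * Complex.I) s =
        ∫ s in (0 : ℝ)..t, (‖traceKernel β ξ s‖ : ℂ) := by
      refine intervalIntegral.integral_congr_ae ?_
      filter_upwards [h.isTrace.ae_nonneg fun τ hτ => (h.mem τ hτ).2.1] with s hs hmem
      rw [uIoc_of_le ht] at hmem
      exact (ofReal_norm_traceKernel (hs hmem.1.le) ξ).symm
    rw [Function.comp_apply, hnorm, intervalIntegral.integral_ofReal, Complex.ofReal_re, id]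

theorem phi_fourierAlong_eq_integral_Ioi {τ : ℝ} (hτ : 0 ≤ τ) :
    phi N p (fourierAlong η ξ τ) = ∫ s in Ioi τ, traceKernel β ξ s := by
  have hint := h.integrableOn_traceKernel hQ hξ
  have hzero : phi N p (fourierAlong η ξ 0) = ∫ s in Ioi 0, traceKernel β ξ s :=
    tendsto_nhds_unique (h.tendsto_intervalIntegral_traceKernel hQ hξ)
      (intervalIntegral_tendsto_integral_Ioi 0 hint tendsto_id)
  rw [h.phi_fourierAlong_eq hQ hξ hτ, hzero, ← intervalIntegral.integral_Ioi_sub_Ioi hint hτ,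
    sub_sub_cancel]

end IsSolutionWithTrace

end Solution

/-- The function `x ↦ β(log x) / x` on `[1,∞)`, extended by zero. For the trace `β` of a solution
with initial value `η₀`, it is the function `𝒩(η₀)`. -/
def traceProfile (β : ℝ → ℝ) : ℝ → ℝ :=
  indicator (Ici 1) fun x => β (Real.log x) / x

theorem dilation_zero_traceProfile (β : ℝ → ℝ) :
    dilation 0 (traceProfile β) = traceProfile β := by
  simp only [dilation, Real.exp_zero, one_mul, traceProfile, indicator_indicator, inter_self]

theorem exp_sub_mul_dilation_traceProfile (β : ℝ → ℝ) {s τ : ℝ} (hτ : 0 ≤ τ) (hs : τ ≤ s) :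
    Real.exp (s - τ) * dilation τ (traceProfile β) (Real.exp (s - τ)) = β s := by
  have hmul : Real.exp τ * Real.exp (s - τ) = Real.exp s := by
    rw [← Real.exp_add, add_sub_cancel]
  have hmem_dilation : Real.exp (s - τ) ∈ Ici 1 := Real.one_le_exp (sub_nonneg.2 hs)
  have hmem_profile : Real.exp s ∈ Ici 1 := Real.one_le_exp (hτ.trans hs)
  rw [dilation, indicator_of_mem hmem_dilation, hmul, traceProfile, indicator_of_mem hmem_profile,
    Real.log_exp, mul_left_comm, ← mul_assoc, hmul, mul_div_cancel₀ _ (Real.exp_ne_zero s)]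

theorem integrableOn_expMul_dilation_traceProfile {β : ℝ → ℝ} {ξ : ℂ} {τ : ℝ} (hτ : 0 ≤ τ)
    (h : IntegrableOn (traceKernel β ξ) (Ioi τ)) :
    IntegrableOn (expMul (Real.exp τ * ξ) (dilation τ (traceProfile β))) (Ioi 1) := by
  rw [← Real.exp_zero, ← sub_self τ, ← image_exp_sub_Ioi]
  exact (integrableOn_image_exp_sub_iff measurableSet_Ioi (ae_of_all _ fun s hs =>
    (exp_sub_mul_dilation_traceProfile β hτ (le_of_lt hs)).symm) ξ).2 h

theorem fourier_dilation_traceProfile (β : ℝ → ℝ) (ξ : ℂ) {τ : ℝ} (hτ : 0 ≤ τ) :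
    fourier (dilation τ (traceProfile β)) (Real.exp τ * ξ) = ∫ s in Ioi τ, traceKernel β ξ s := by
  rw [← setIntegral_image_exp_sub measurableSet_Ioi (ae_of_all _ fun s hs =>
    (exp_sub_mul_dilation_traceProfile β hτ (le_of_lt hs)).symm) ξ, image_exp_sub_Ioi, sub_self,
    Real.exp_zero]
  rfl

namespace HasFourier

variable {w v : ℝ → ℝ} {g : ℂ → ℂ}

theorem of_integrableOn_expMul (hw : ∀ x, x < 1 → w x = 0)
    (hint : ∀ ζ : ℂ, ζ.im < 0 → IntegrableOn (expMul ζ w) (Ioi 1))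
    (hg : ∀ ζ : ℂ, ζ.im < 0 → fourier w ζ = g ζ) : HasFourier w g := by
  have hreal (ε : ℝ) (hε : 0 < ε) :
      IntegrableOn (fun x : ℝ => Real.exp (-ε * x) * w x) (Ioi 1) := by
    have hcomplex : IntegrableOn (fun x => expMul (-(ε * Complex.I)) w x) (Ioi 1) :=
      hint _ (by simpa using hε)
    simp only [expMul_neg_mul_I] at hcomplex
    exact hcomplex.re
  refine ⟨hw, ?_, hreal, hg⟩
  have hcancel : w = fun x => Real.exp x * (Real.exp (-1 * x) * w x) := by
    ext x
    rw [← mul_assoc, ← Real.exp_add, neg_one_mul, add_neg_cancel, Real.exp_zero, one_mul]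
  rw [hcancel]
  have hIci : IntegrableOn (fun x => Real.exp (-1 * x) * w x) (Ici 1) :=
    (integrableOn_Ici_iff_integrableOn_Ioi enorm_ne_top).2 (hreal 1 one_pos)
  exact hIci.locallyIntegrableOn.continuousOn_mul Real.continuous_exp.continuousOn
    isClosed_Ici.isLocallyClosed

theorem integrable_indicator_expMul (h : HasFourier w g) :
    Integrable ((Ioi 1).indicator (expMul (-Complex.I) w)) := by
  have hcomplex : IntegrableOn (fun x => expMul (-((1 : ℝ) * Complex.I)) w x) (Ioi 1) := by
    simp only [expMul_neg_mul_I]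
    exact (h.integrable_exp 1 one_pos).ofReal
  rw [Complex.ofReal_one, one_mul] at hcomplex
  exact (integrable_indicator_iff measurableSet_Ioi).2 hcomplex

theorem fourier_indicator_expMul (h : HasFourier w g) (t : ℝ) :
    𝓕 ((Ioi 1).indicator (expMul (-Complex.I) w)) t = g (2 * Real.pi * t - Complex.I) := by
  rw [← h.fourier_eq _ (by simp), Real.fourier_eq', fourier, ← integral_indicator measurableSet_Ioi]
  congr 1 with x
  by_cases hx : x ∈ Ioi 1
  · rw [indicator_of_mem hx, indicator_of_mem hx, expMul, smul_eq_mul, ← mul_assoc,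
      ← Complex.exp_add]
    congr 2
    simp only [RCLike.inner_apply, conj_trivial]
    push_cast
    ring
  · rw [indicator_of_notMem hx, indicator_of_notMem hx, smul_zero]

theorem ae_eq (hw : HasFourier w g) (hv : HasFourier v g) : w =ᵐ[volume] v := by
  have hweighted := ae_eq_of_fourier_eq hw.integrable_indicator_expMul
    hv.integrable_indicator_expMul <| by
      ext t
      rw [hw.fourier_indicator_expMul, hv.fourier_indicator_expMul]
  filter_upwards [hweighted, Measure.ae_ne volume (1 : ℝ)] with x hx hx1
  rcases lt_or_gt_of_ne hx1 with hlt | hgt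
  · rw [hw.eq_zero x hlt, hv.eq_zero x hlt]
  · rw [indicator_of_mem (mem_Ioi.2 hgt), indicator_of_mem (mem_Ioi.2 hgt)] at hx
    exact Complex.ofReal_injective (mul_left_cancel₀ (Complex.exp_ne_zero _) hx)

theorem fourierInv (h : HasFourier w g) : HasFourier (fourierInv g) g := by
  have hexists : ∃ w, HasFourier w g := ⟨w, h⟩
  rw [Coarsening.fourierInv, dif_pos hexists]
  exact hexists.choose_spec

theorem fourierInv_ae_eq (h : HasFourier w g) : Coarsening.fourierInv g =ᵐ[volume] w :=
  h.fourierInv.ae_eq h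

end HasFourier

section Solution

variable {N : ℕ} {p : ℕ → ℝ} {η₀ : L1R} {η : ℝ → L1R} {β : ℝ → ℝ}

namespace IsSolutionWithTrace

variable (h : IsSolutionWithTrace N p η₀ η β)
include h

theorem fourier_zero : fourier (η 0) = fourier η₀ := by
  have hη : η 0 = dilationL1 0 η₀ := by simpa using h.eq_dilationL1_add_integral 0 le_rfl
  ext ζ
  rw [hη, dilationL1, ← truncFourier_one, truncFourier_congr_ae _ _ (Integrable.coeFn_toL1 _),
    truncFourier_one, fourier_dilation_zero]

theorem hasFourier_dilation_traceProfile (hQ : ∀ z : ℂ, ‖z‖ < 1 → Qpoly N p z ≠ 1) {τ : ℝ}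
    (hτ : 0 ≤ τ) :
    HasFourier (dilation τ (traceProfile β)) fun ξ => phi N p (fourier (η τ) ξ) := by
  have hrescale (ζ : ℂ) (hζ : ζ.im < 0) : ∃ ξ : ℂ, ξ.im < 0 ∧ Real.exp τ * ξ = ζ := by
    refine ⟨Real.exp (-τ) * ζ, ?_, ?_⟩
    · rw [exp_mul_im]
      exact mul_neg_of_pos_of_neg (Real.exp_pos _) hζ
    · rw [← mul_assoc, ← Complex.ofReal_mul, ← Real.exp_add, add_neg_cancel, Real.exp_zero,
        Complex.ofReal_one, one_mul]
  refine .of_integrableOn_expMul (fun x hx => indicator_of_notMem (not_le.2 hx) _)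
    (fun ζ hζ => ?_) fun ζ hζ => ?_
  all_goals obtain ⟨ξ, hξ, rfl⟩ := hrescale ζ hζ
  · exact integrableOn_expMul_dilation_traceProfile hτ <|
      (h.integrableOn_traceKernel hQ hξ).mono_set (Ioi_subset_Ioi hτ)
  · rw [fourier_dilation_traceProfile β ξ hτ, ← h.phi_fourierAlong_eq_integral_Ioi hQ hξ hτ,
      fourierAlong]

theorem Nmap_initial_ae_eq (hQ : ∀ z : ℂ, ‖z‖ < 1 → Qpoly N p z ≠ 1) :
    Nmap N p η₀ =ᵐ[volume] traceProfile β := by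
  have hprofile := h.hasFourier_dilation_traceProfile hQ le_rfl
  rw [dilation_zero_traceProfile, h.fourier_zero] at hprofile
  exact hprofile.fourierInv_ae_eq

end IsSolutionWithTrace

end Solution

end Coarsening

end

theorem proposition3p4_general (N : ℕ) (p : ℕ → ℝ)
    (hQ : ∀ z : ℂ, ‖z‖ < 1 → Coarsening.Qpoly N p z ≠ 1)
    (η₀ : Coarsening.L1R) (η : ℝ → Coarsening.L1R) (hη : Coarsening.IsSolution N p η₀ η) :
    ∀ τ : ℝ, 0 ≤ τ →
      Coarsening.HasFourier (Coarsening.Nmap N p (η τ))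
          (fun ξ => Coarsening.phi N p (Coarsening.fourier (η τ) ξ)) ∧
        Coarsening.Nmap N p (η τ) =ᵐ[MeasureTheory.volume]
          Coarsening.dilation τ (Coarsening.Nmap N p η₀) := by
  intro τ hτ
  obtain ⟨β, hβ⟩ := hη.exists_isSolutionWithTrace
  have hprofile := hβ.hasFourier_dilation_traceProfile hQ hτ
  exact ⟨hprofile.fourierInv, hprofile.fourierInv_ae_eq.trans
    (Coarsening.dilation_congr_ae τ (hβ.Nmap_initial_ae_eq hQ)).symm⟩

/-- The first conjunct says that `𝒩(η(τ))` is defined, i.e. that the inverse Fourier transform in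
its definition exists in `L¹_loc([1,∞))`; the second one is the conjugation formula. -/
theorem proposition3p4 (N : ℕ) (p : ℕ → ℝ)
    (hp : ∀ j ∈ Finset.Icc 1 N, 0 ≤ p j) (hp1 : ∑ j ∈ Finset.Icc 1 N, p j = 1)
    (η₀ : Coarsening.L1R) (hη₀ : η₀ ∈ Coarsening.probDensities)
    (η : ℝ → Coarsening.L1R) (hη : Coarsening.IsSolution N p η₀ η) :
    ∀ τ : ℝ, 0 ≤ τ →
      Coarsening.HasFourier (Coarsening.Nmap N p (η τ))
          (fun ξ => Coarsening.phi N p (Coarsening.fourier (η τ) ξ)) ∧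
        Coarsening.Nmap N p (η τ) =ᵐ[MeasureTheory.volume]
          Coarsening.dilation τ (Coarsening.Nmap N p η₀) :=
  proposition3p4_general N p (fun _ => Coarsening.Qpoly_ne_one hp hp1.le) η₀ η hη
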